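/- All graphs are finite and simple. For graphs $G$ and $H$, the Ramsey number $r(G,H)$ is the least positive integer $N$ such that every red-blue coloring of the edges of the complete graph $K_N$ contains a red copy of $G$ or a blue copy of $H$ (as a subgraph, not necessarily induced). For $k\ge 1$, the book $B_k=K_2+\overline{K}_k$ is the graph on $k+2$ vertices formed by two adjacent vertices together with $k$ pairwise non-adjacent vertices, each adjacent to both of the first two. Let $k\ge 1$ and $n\ge 6k^3$ be integers, and let $G$ be a connected graph with $n$ vertices and at most $$n\left(1+\frac{1}{9k^2+\frac{23k}{2}+3}\right)$$ edges. Then $$r(G,B_k)\le 2n+k-2.$$ -/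

import Mathlib

namespace SparseBook

/-- The join `G + H`: the disjoint union of `G` and `H` together with all edges between a vertex
of `G` and a vertex of `H`. -/
def join {V W : Type*} (G : SimpleGraph V) (H : SimpleGraph W) : SimpleGraph (V ⊕ W) :=
  SimpleGraph.sum G H ⊔ completeBipartiteGraph V W

/-- The book `B_k`, that is, the join of the complete graph on two vertices and the empty graph
on `k` vertices. -/
def book (k : ℕ) : SimpleGraph (Fin 2 ⊕ Fin k) :=
  join (⊤ : SimpleGraph (Fin 2)) (⊥ : SimpleGraph (Fin k))

/-- Every red-blue colouring of the edges of the complete graph on `N` vertices contains a red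
copy of `G` or a blue copy of `H`. A colouring is given by its graph `R` of red edges; the blue
edges are those of the complement. Copies are not required to be induced. -/
def Arrows (N : ℕ) {V W : Type*} (G : SimpleGraph V) (H : SimpleGraph W) : Prop :=
  ∀ R : SimpleGraph (Fin N), SimpleGraph.IsContained G R ∨ SimpleGraph.IsContained H Rᶜ

/-- The Ramsey number `r(G, H)`: the least positive `N` such that every red-blue colouring of the edges of
the complete graph on `N` vertices contains a red `G` or a blue `H`. It is taken in `ℕ∞`, so that
a bound on it from above also says that such an `N` exists. -/
noncomputable def ramseyNumber {V W : Type*} (G : SimpleGraph V) (H : SimpleGraph W) : ℕ∞ :=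
  ⨅ (N : ℕ) (_ : 0 < N ∧ Arrows N G H), (N : ℕ∞)

end SparseBook

namespace SparseBook

open SimpleGraph

/-! Call edges of `R` red and edges of its complement blue, and let `l` be the excess of edges over
vertices in `G`. Suppose there is no blue book.

Any connected graph can be taken apart by deleting leaves and by shortening long suspended paths or
cycles, neither of which raises the excess. What remains has minimum degree two and no suspended
path or cycle with `3k + 1` edges. It is then either a cycle on at most `3k` vertices or a core with
at most `9kl` edges (`exists_suspended_or_edges_le`). So `G` embeds in red once cores embed, leaves
can be reattached and paths can be lengthened (`isContained_of_host`).

Lengthening rests on `IsPathOrCycle.absorb`: a vertex with more than `k` red neighbours on a path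
either enters it, directly or after a reversal, or creates a blue book. There are two cases.

If some vertex has blue degree at least `n + k - 1`, its blue neighbourhood has internal blue
degrees below `k`, and all three tasks succeed there (`isContained_of_compl_degree_lt`).

Otherwise all blue degrees are at most `n + k - 2`, which allows leaves. If a path cannot be
lengthened, each unused vertex has at most `k` red neighbours among `3k` path vertices, so a blue
pair of unused vertices would share `k` blue neighbours. Hence the unused vertices form a red
clique, large enough to hold `G`. Cores embed by `CoBookFree.isContained_of_card_add_le`. -/

/-! ### Book-free complements -/

/-- The complement of `R` contains no book with `k` pages: any two vertices that are not adjacent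
in `R` have fewer than `k` common non-neighbours. -/
def CoBookFree {M : Type*} (k : ℕ) (R : SimpleGraph M) : Prop :=
  ∀ u v, Rᶜ.Adj u v → ∀ T : Finset M, (∀ w ∈ T, Rᶜ.Adj u w ∧ Rᶜ.Adj v w) → T.card < k

theorem isContained_of_injective {V M : Type*} {H : SimpleGraph V} {R : SimpleGraph M}
    (f : V → M) (hf : Function.Injective f) (h : ∀ u v, H.Adj u v → R.Adj (f u) (f v)) :
    H.IsContained R :=
  ⟨⟨⟨f, fun {u v} => h u v⟩, hf⟩⟩

theorem coBookFree_of_not_isContained {M : Type*} {k : ℕ} {R : SimpleGraph M}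
    (h : ¬ (book k).IsContained Rᶜ) : CoBookFree k R := by
  intro u v huv T hT
  by_contra! hcard
  obtain ⟨T', hT', hcard'⟩ := Finset.exists_subset_card_eq hcard
  let e : Fin k ≃ T' := (T'.equivFinOfCardEq hcard').symm
  have he : ∀ i, Rᶜ.Adj u (e i) ∧ Rᶜ.Adj v (e i) := fun i => hT _ (hT' (e i).2)
  refine h (isContained_of_injective
    (Sum.elim (fun i : Fin 2 => if i = 0 then u else v) (fun i => (e i : M))) ?_ ?_)
  · refine Function.Injective.sumElim ?_ (fun i j hij => e.injective (Subtype.ext hij)) ?_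
    · intro i j hij
      have := huv.ne
      fin_cases i <;> fin_cases j <;> simp_all
    · intro i j
      split_ifs
      · exact (he j).1.ne
      · exact (he j).2.ne
  · have huv' := huv.symm
    have he1 : ∀ i, Rᶜ.Adj (e i) u := fun i => (he i).1.symm
    have he2 : ∀ i, Rᶜ.Adj (e i) v := fun i => (he i).2.symm
    rintro (i | i) (j | j) hij
    · simp only [book, join, sup_adj, sum_adj, top_adj] at hij
      fin_cases i <;> fin_cases j <;> simp_all
    · simp only [Sum.elim_inl, Sum.elim_inr]
      split_ifs
      exacts [(he j).1, (he j).2]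
    · simp only [Sum.elim_inl, Sum.elim_inr]
      split_ifs
      exacts [he1 i, he2 i]
    · simp [book, join] at hij

theorem compl_adj_of_induce {M : Type*} {R : SimpleGraph M} {S : Set M} {a b : S}
    (h : (R.induce S)ᶜ.Adj a b) : Rᶜ.Adj (a : M) b :=
  (compl_adj _ _ _).2 ⟨fun hab => h.1 (Subtype.ext hab), h.2⟩

theorem CoBookFree.induce {M : Type*} {k : ℕ} {R : SimpleGraph M} (h : CoBookFree k R)
    (S : Set M) : CoBookFree k (R.induce S) := by
  intro u v huv T hT
  have := h u v (compl_adj_of_induce huv) (T.map (Function.Embedding.subtype _)) (by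
    intro w hw
    obtain ⟨w', hw', rfl⟩ := Finset.mem_map.1 hw
    exact ⟨compl_adj_of_induce (hT w' hw').1, compl_adj_of_induce (hT w' hw').2⟩)
  simpa using this

/-! ### Red cliques from sparse blue graphs -/

/-- Greedy choice: each chosen vertex costs itself and fewer than `k` non-neighbours, hence at most
`k` candidates, so `k * t` candidates last for `t` rounds. -/
theorem exists_clique_of_sparse_compl {M : Type*} {k : ℕ} {R : SimpleGraph M} (hk : 0 < k) (t : ℕ)
    (S : Finset M)
    (hdeg : ∀ x ∈ S, ∀ T ⊆ S, (∀ w ∈ T, Rᶜ.Adj x w) → T.card < k) (hS : k * t ≤ S.card) :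
    ∃ T ⊆ S, T.card = t ∧ R.IsClique T := by
  classical
  induction t generalizing S with
  | zero => exact ⟨∅, by simp⟩
  | succ t ih =>
    obtain ⟨x, hx⟩ : S.Nonempty :=
      Finset.card_pos.1 ((Nat.mul_pos hk t.succ_pos).trans_le hS)
    have hlt := hdeg x hx (S.filter fun w => Rᶜ.Adj x w) (Finset.filter_subset _ _)
      (fun w hw => (Finset.mem_filter.1 hw).2)
    let S' := (S.erase x).filter fun w => R.Adj x w
    have hsplit : S.card ≤ S'.card + (S.filter fun w => Rᶜ.Adj x w).card + 1 := by
      have : S ⊆ (S' ∪ S.filter fun w => Rᶜ.Adj x w) ∪ {x} := by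
        intro w hw
        by_cases hwx : w = x
        · simp [hwx]
        · by_cases hR : R.Adj x w
          · simp [S', hw, hwx, hR]
          · simp [hw, hwx, hR, compl_adj, Ne.symm hwx]
      refine (Finset.card_le_card this).trans ((Finset.card_union_le _ _).trans ?_)
      simpa using Finset.card_union_le _ _
    have hS'S : S' ⊆ S := (Finset.filter_subset _ _).trans (Finset.erase_subset _ _)
    obtain ⟨T, hTS, hTc, hT⟩ := ih S' (fun y hy U hU => hdeg y (hS'S hy) U (hU.trans hS'S))
      (by rw [mul_add, mul_one] at hS; omega)
    have hxT : x ∉ T := fun h => by simpa [S'] using hTS h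
    refine ⟨insert x T, Finset.insert_subset hx (hTS.trans hS'S), by simp [hxT, hTc], ?_⟩
    rw [Finset.coe_insert, isClique_insert]
    exact ⟨hT, fun b hb _ => (Finset.mem_filter.1 (hTS hb)).2⟩

theorem isContained_of_isClique {V M : Type*} [Fintype V] {H : SimpleGraph V}
    {R : SimpleGraph M} {T : Finset M} (hT : R.IsClique T) (hc : Fintype.card V ≤ T.card) :
    H.IsContained R := by
  obtain ⟨f⟩ : Nonempty (V ↪ T) := by
    rw [Function.Embedding.nonempty_iff_card_le]; simpa using hc
  refine isContained_of_injective (fun v => (f v : M))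
    (fun a b hab => f.injective (Subtype.ext hab)) fun u v huv => hT (f u).2 (f v).2 ?_
  exact fun h => huv.ne (f.injective (Subtype.ext h))

/-- A vertex with many non-neighbours yields a large clique among them. -/
theorem CoBookFree.isContained_of_blue_degree {V M : Type*} [Fintype V] {H : SimpleGraph V}
    {k : ℕ} {R : SimpleGraph M} (hk : 1 ≤ k) (hR : CoBookFree k R) (u : M) (S : Finset M)
    (hS : ∀ w ∈ S, Rᶜ.Adj u w) (hc : k * Fintype.card V ≤ S.card) : H.IsContained R := by
  obtain ⟨T, -, hTc, hT⟩ := exists_clique_of_sparse_compl (R := R) (k := k) hk (Fintype.card V) S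
    (fun x hx T hTS hT => hR u x (hS x hx) T fun w hw => ⟨hS w (hTS hw), hT w hw⟩) hc
  exact isContained_of_isClique hT hTc.ge

/-! ### Vertex deletion and embedding by edge count -/

theorem isContained_of_induce_compl_singleton {V M : Type*} {H : SimpleGraph V}
    {R : SimpleGraph M} (x : V) (f : ({x}ᶜ : Set V) → M) (hf : Function.Injective f)
    (hfadj : ∀ u v : ({x}ᶜ : Set V), H.Adj u v → R.Adj (f u) (f v)) (y : M)
    (hy : ∀ u, f u ≠ y) (hadj : ∀ u : ({x}ᶜ : Set V), H.Adj x u → R.Adj y (f u)) :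
    H.IsContained R := by
  classical
  refine isContained_of_injective (fun v => if h : v = x then y else f ⟨v, h⟩) ?_ ?_
  · intro a b hab
    by_cases ha : a = x <;> by_cases hb : b = x <;> simp only [ha, hb, dite_true, dite_false] at hab
    · exact ha.trans hb.symm
    · exact absurd hab.symm (hy _)
    · exact absurd hab (hy _)
    · exact congrArg Subtype.val (hf hab)
  · intro a b hab
    by_cases ha : a = x <;> by_cases hb : b = x <;> simp only [ha, hb, dite_true, dite_false]
    · exact absurd (ha.trans hb.symm) hab.ne
    · exact hadj _ (ha ▸ hab)
    · exact (hadj ⟨a, ha⟩ (hb ▸ hab).symm).symm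
    · exact hfadj ⟨a, ha⟩ ⟨b, hb⟩ hab

theorem ncard_neighborSet_eq_degree {V : Type*} (H : SimpleGraph V) (x : V)
    [Fintype (H.neighborSet x)] : (H.neighborSet x).ncard = H.degree x := by
  rw [Set.ncard_eq_toFinset_card', ← card_neighborSet_eq_degree, Set.toFinset_card]

theorem ncard_edgeSet_eq_card {V : Type*} (H : SimpleGraph V) [Fintype H.edgeSet] :
    H.edgeSet.ncard = H.edgeFinset.card := by
  rw [Set.ncard_eq_toFinset_card', edgeFinset]

theorem sum_ncard_neighborSet {V : Type*} [Fintype V] (H : SimpleGraph V) :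
    ∑ x, (H.neighborSet x).ncard = 2 * H.edgeSet.ncard := by
  classical
  rw [ncard_edgeSet_eq_card, ← H.sum_degrees_eq_twice_card_edges]
  exact Finset.sum_congr rfl fun x _ => ncard_neighborSet_eq_degree H x

theorem ncard_edgeSet_induce_compl_singleton {V : Type*} [Fintype V] (H : SimpleGraph V) (x : V) :
    (H.induce {x}ᶜ).edgeSet.ncard + (H.neighborSet x).ncard = H.edgeSet.ncard := by
  classical
  have h1 : H.degree x ≤ H.edgeFinset.card := by
    rw [← card_incidenceFinset_eq_degree]
    exact Finset.card_le_card (H.incidenceFinset_subset x)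
  rw [ncard_edgeSet_eq_card, ncard_edgeSet_eq_card, ncard_neighborSet_eq_degree,
    card_edgeFinset_induce_compl_singleton, card_edgeFinset_deleteIncidenceSet]
  omega

theorem card_compl_singleton {V : Type*} [Fintype V] (x : V) [Fintype ({x}ᶜ : Set V)] :
    Fintype.card ({x}ᶜ : Set V) + 1 = Fintype.card V := by
  classical
  have : 0 < Fintype.card V := Fintype.card_pos_iff.2 ⟨x⟩
  rw [Fintype.card_compl_set, Set.card_singleton]
  omega

/-- A graph with `v` vertices and `m` edges is contained in every graph on at least `v + 2 k m`
vertices whose complement has no book with `k` pages. -/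
theorem CoBookFree.isContained_of_card_add_le {V : Type*} [Fintype V] {M : Type*} [Fintype M]
    {k : ℕ} {R : SimpleGraph M} (hk : 1 ≤ k) (hR : CoBookFree k R) (H : SimpleGraph V)
    (hc : Fintype.card V + 2 * k * H.edgeSet.ncard ≤ Fintype.card M) : H.IsContained R := by
  classical
  induction hv : Fintype.card V generalizing V with
  | zero =>
    have := Fintype.card_eq_zero_iff.1 hv
    exact isContained_of_injective isEmptyElim (fun a => isEmptyElim a) fun a => isEmptyElim a
  | succ v ih =>
    have : Nonempty V := Fintype.card_pos_iff.1 (by omega)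
    obtain ⟨x, hx⟩ := Finite.exists_min fun x => (H.neighborSet x).ncard
    set d := (H.neighborSet x).ncard with hd
    have hdm : Fintype.card V * d ≤ 2 * H.edgeSet.ncard := by
      rw [← sum_ncard_neighborSet, ← Finset.card_univ, ← smul_eq_mul]
      exact Finset.card_nsmul_le_sum _ _ _ fun y _ => hx y
    have hcard := card_compl_singleton x
    have hedge := ncard_edgeSet_induce_compl_singleton H x
    obtain ⟨f⟩ := ih (H.induce {x}ᶜ) (by
      refine le_trans (Nat.add_le_add (by omega) (Nat.mul_le_mul_left _ ?_)) hc
      omega) (by omega)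
    by_cases hex : ∃ y, (∀ u, f u ≠ y) ∧ ∀ u : ({x}ᶜ : Set V), H.Adj x u → R.Adj y (f u)
    · obtain ⟨y, hy, hadj⟩ := hex
      exact isContained_of_induce_compl_singleton x f f.injective
        (fun u w huw => f.toHom.map_adj huw) y hy hadj
    push Not at hex
    let Y : Finset M := Finset.univ \ Finset.univ.image f
    have hY : Y.card + v = Fintype.card M := by
      have h1 : (Finset.univ.image f).card = v := by
        rw [Finset.card_image_of_injective _ (f := f) f.injective, Finset.card_univ]; omega
      have := Finset.card_sdiff_add_card_eq_card (Finset.subset_univ (Finset.univ.image f))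
      rw [h1, Finset.card_univ] at this
      exact this
    let A : Finset ({x}ᶜ : Set V) := Finset.univ.filter fun u => H.Adj x u
    have hA : A.card ≤ d := by
      rw [hd, Set.ncard_eq_toFinset_card']
      refine Finset.card_le_card_of_injOn (fun u => (u : V)) (fun u hu => ?_)
        Subtype.val_injective.injOn
      simpa [A] using hu
    -- If no unused vertex can play `x`, each is blue to one of at most `d` images. An image with
    -- more than `k * |V|` blue neighbours would give a clique containing `H`, so there are at most
    -- `d * k * |V| ≤ 2 * k * m` unused vertices, where `m` is the number of edges of `H`. This is
    -- fewer than are available.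
    have hcover : Y ⊆ A.biUnion fun u => Y.filter fun y => Rᶜ.Adj (f u) y := by
      intro y hy
      have hyf : ∀ u, f u ≠ y := by
        intro u hu
        simp only [Y, Finset.mem_sdiff, Finset.mem_image] at hy
        exact hy.2 ⟨u, Finset.mem_univ _, hu⟩
      obtain ⟨u, hxu, hyu⟩ := hex y hyf
      rw [Finset.mem_biUnion]
      exact ⟨u, by simpa [A] using hxu, Finset.mem_filter.2
        ⟨hy, (compl_adj _ _ _).2 ⟨hyf u, fun h => hyu h.symm⟩⟩⟩
    by_contra hcon
    have hsmall : ∀ u ∈ A, (Y.filter fun y => Rᶜ.Adj (f u) y).card ≤ k * Fintype.card V := by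
      intro u _
      by_contra! hlt
      exact hcon (hR.isContained_of_blue_degree hk (f u) _
        (fun w hw => (Finset.mem_filter.1 hw).2) hlt.le)
    have h1 : Y.card ≤ d * (k * Fintype.card V) :=
      (Finset.card_le_card hcover).trans ((Finset.card_biUnion_le_card_mul _ _ _ hsmall).trans
        (Nat.mul_le_mul_right _ hA))
    have h2 : d * (k * Fintype.card V) ≤ 2 * k * H.edgeSet.ncard := by
      calc _ = k * (Fintype.card V * d) := by ring
        _ ≤ k * (2 * H.edgeSet.ncard) := Nat.mul_le_mul_left _ hdm
        _ = _ := by ring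
    omega

/-! ### Absorbing a vertex into a path or cycle -/

/-- `z 0, …, z p` is a path or a cycle with `p` edges in `R`. -/
structure IsPathOrCycle {M : Type*} (R : SimpleGraph M) (z : ℕ → M) (p : ℕ) : Prop where
  adj : ∀ i < p, R.Adj (z i) (z (i + 1))
  inj : ∀ i j, i < j → j ≤ p → z i = z j → i = 0 ∧ j = p

theorem IsPathOrCycle.insert {M : Type*} {R : SimpleGraph M} {z : ℕ → M} {p : ℕ}
    (hz : IsPathOrCycle R z p) {y : M} (hy : ∀ i ≤ p, z i ≠ y) {i : ℕ} (hi : i < p)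
    (h1 : R.Adj y (z i)) (h2 : R.Adj y (z (i + 1))) :
    ∃ w : ℕ → M, IsPathOrCycle R w (p + 1) ∧ w 0 = z 0 ∧ w (p + 1) = z p ∧
      ∀ m ≤ p + 1, w m = y ∨ ∃ j ≤ p, w m = z j := by
  refine ⟨fun m => if m ≤ i then z m else if m = i + 1 then y else z (m - 1), ⟨?_, ?_⟩, ?_, ?_, ?_⟩
  · intro m hm
    rcases lt_trichotomy m i with h | rfl | h
    · simpa [h.le, Nat.succ_le_of_lt h] using hz.adj m (by omega)
    · simpa using h1.symm
    · rcases (Nat.succ_le_of_lt h).eq_or_lt with rfl | h'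
      · simpa using h2
      · have := hz.adj (m - 1) (by omega)
        rw [Nat.sub_add_cancel (by omega)] at this
        simpa [show ¬ m ≤ i by omega, show ¬ m + 1 ≤ i by omega, show m ≠ i + 1 by omega,
          show m ≠ i by omega] using this
  · intro a b hab hb heq
    have key := fun c d hcd hd h => hz.inj c d hcd hd h
    split_ifs at heq with c1 c2 c3 c4 c5 c6
    · have := key a b hab (by omega) heq; omega
    · exact absurd heq (hy _ (by omega))
    · have := key a (b - 1) (by omega) (by omega) heq; omega
    all_goals first
      | omega
      | exact absurd heq.symm (hy _ (by omega))
      | (have := key (a - 1) (b - 1) (by omega) (by omega) heq; omega)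
  · simp
  · simp [show ¬ p + 1 ≤ i by omega, show p ≠ i by omega]
  · intro m hm
    simp only
    split_ifs
    · exact Or.inr ⟨m, by omega, rfl⟩
    · exact Or.inl rfl
    · exact Or.inr ⟨m - 1, by omega, rfl⟩

/-- The new order is `z 0 … z i, y, z j, z (j-1) … z (i+1), z (j+1) … z p`: the segment between the
two neighbours of `y` is reversed. -/
theorem IsPathOrCycle.rotate {M : Type*} {R : SimpleGraph M} {z : ℕ → M} {p : ℕ}
    (hz : IsPathOrCycle R z p) {y : M} (hy : ∀ i ≤ p, z i ≠ y) {i j : ℕ} (hij : i < j) (hj : j < p)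
    (h1 : R.Adj y (z i)) (h2 : R.Adj y (z j)) (h3 : R.Adj (z (i + 1)) (z (j + 1))) :
    ∃ w : ℕ → M, IsPathOrCycle R w (p + 1) ∧ w 0 = z 0 ∧ w (p + 1) = z p ∧
      ∀ m ≤ p + 1, w m = y ∨ ∃ j ≤ p, w m = z j := by
  refine ⟨fun m => if m ≤ i then z m else if m = i + 1 then y else
    if m ≤ j + 1 then z (j + i + 2 - m) else z (m - 1), ⟨?_, ?_⟩, ?_, ?_, ?_⟩
  · intro m hm
    rcases lt_trichotomy m i with h | rfl | h
    · simpa [h.le, Nat.succ_le_of_lt h] using hz.adj m (by omega)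
    · simpa using h1.symm
    simp only [show ¬ m ≤ i by omega, show ¬ m + 1 ≤ i by omega, show m + 1 ≠ i + 1 by omega,
      if_false]
    rcases (Nat.succ_le_of_lt h).eq_or_lt with rfl | h'
    · simpa [hij, show j + i + 2 - (i + 1 + 1) = j by omega] using h2
    simp only [show m ≠ i + 1 by omega, if_false]
    rcases lt_trichotomy m (j + 1) with h'' | rfl | h''
    · have := hz.adj (j + i + 2 - (m + 1)) (by omega)
      rw [show j + i + 2 - (m + 1) + 1 = j + i + 2 - m by omega] at this
      simpa [show m ≤ j + 1 by omega, show m ≤ j by omega] using this.symm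
    · simpa [show j + i + 2 - (j + 1) = i + 1 by omega] using h3
    · have := hz.adj (m - 1) (by omega)
      rw [Nat.sub_add_cancel (by omega)] at this
      simpa [show ¬ m ≤ j + 1 by omega, show ¬ m ≤ j by omega] using this
  · intro a b hab hb heq
    have key : ∀ c d, c ≤ p → d ≤ p → z c = z d →
        c = d ∨ (c = 0 ∧ d = p) ∨ (d = 0 ∧ c = p) := by
      intro c d hc hd h
      rcases lt_trichotomy c d with h' | h' | h'
      · exact Or.inr (Or.inl (hz.inj c d h' hd h))
      · exact Or.inl h'
      · exact Or.inr (Or.inr (hz.inj d c h' hc h.symm))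
    split_ifs at heq
    all_goals first
      | omega
      | exact absurd heq (hy _ (by omega))
      | exact absurd heq.symm (hy _ (by omega))
      | (have := key _ _ (by omega) (by omega) heq; omega)
  · simp
  · simp [show ¬ p + 1 ≤ i by omega, show p ≠ i by omega, show ¬ p ≤ j by omega]
  · intro m hm
    simp only
    split_ifs
    · exact Or.inr ⟨m, by omega, rfl⟩
    · exact Or.inl rfl
    · exact Or.inr ⟨_, by omega, rfl⟩
    · exact Or.inr ⟨m - 1, by omega, rfl⟩

/-- A vertex `y` that cannot be absorbed into a path or cycle has at most `k` neighbours on it. -/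
theorem IsPathOrCycle.absorb {M : Type*} {R : SimpleGraph M} {z : ℕ → M} {p k : ℕ}
    (hR : CoBookFree k R) (hz : IsPathOrCycle R z p) {y : M} (hy : ∀ i ≤ p, z i ≠ y)
    (I : Finset ℕ) (hI : ∀ i ∈ I, i < p ∧ R.Adj y (z i)) (hcard : k < I.card) :
    ∃ w : ℕ → M, IsPathOrCycle R w (p + 1) ∧ w 0 = z 0 ∧ w (p + 1) = z p ∧
      ∀ m ≤ p + 1, w m = y ∨ ∃ j ≤ p, w m = z j := by
  classical
  by_contra hno
  have hblue : ∀ i ∈ I, Rᶜ.Adj y (z (i + 1)) := fun i hi =>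
    (compl_adj _ _ _).2 ⟨(hy _ (hI i hi).1).symm, fun h =>
      hno (hz.insert hy (hI i hi).1 (hI i hi).2 h)⟩
  have hinj : ∀ i ∈ I, ∀ j ∈ I, z (i + 1) = z (j + 1) → i = j := by
    intro i hi j hj h
    have h1 := (hI i hi).1
    have h2 := (hI j hj).1
    rcases lt_trichotomy i j with h' | h' | h'
    · have := hz.inj _ _ (Nat.succ_lt_succ h') h2 h; omega
    · exact h'
    · have := hz.inj _ _ (Nat.succ_lt_succ h') h1 h.symm; omega
  have hpair : ∀ i ∈ I, ∀ j ∈ I, i < j → ¬ R.Adj (z (i + 1)) (z (j + 1)) := fun i hi j hj hij h =>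
    hno (hz.rotate hy hij (hI j hj).1 (hI i hi).2 (hI j hj).2 h)
  have hpair' : ∀ i ∈ I, ∀ j ∈ I, i ≠ j → Rᶜ.Adj (z (i + 1)) (z (j + 1)) := by
    intro i hi j hj hij
    refine (compl_adj _ _ _).2 ⟨fun h => hij (hinj i hi j hj h), fun h => ?_⟩
    rcases lt_or_gt_of_ne hij with h' | h'
    · exact hpair i hi j hj h' h
    · exact hpair j hj i hi h' h.symm
  obtain ⟨i, hi⟩ : I.Nonempty := Finset.card_pos.1 (by omega)
  -- The book has spine `y, z (i + 1)`; its pages are the successors of the other neighbours, at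
  -- least `k` of them.
  have := hR y (z (i + 1)) (hblue i hi) ((I.erase i).image fun j => z (j + 1)) (by
    intro w hw
    obtain ⟨j, hj, rfl⟩ := Finset.mem_image.1 hw
    obtain ⟨hji, hj⟩ := Finset.mem_erase.1 hj
    exact ⟨hblue j hj, hpair' i hi j hj (Ne.symm hji)⟩)
  rw [Finset.card_image_of_injOn (fun a ha b hb h =>
    hinj a (Finset.mem_of_mem_erase ha) b (Finset.mem_of_mem_erase hb) h),
    Finset.card_erase_of_mem hi] at this
  omega

/-! ### Suspended paths and the size of the core -/

theorem eq_or_eq_of_ncard_neighborSet {V : Type*} {H : SimpleGraph V} {x a b v : V}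
    (hx : (H.neighborSet x).ncard = 2) (ha : H.Adj x a) (hb : H.Adj x b) (hab : a ≠ b)
    (hv : H.Adj x v) : v = a ∨ v = b := by
  have hsub : ({a, b} : Set V) ⊆ H.neighborSet x := by
    rintro w (rfl | rfl)
    exacts [ha, hb]
  have := Set.eq_of_subset_of_ncard_le hsub (by rw [hx, Set.ncard_pair hab])
    (Set.finite_of_ncard_ne_zero (by omega))
  have hv' : v ∈ ({a, b} : Set V) := this ▸ hv
  simpa using hv'

theorem mem_of_connected_of_closed {V : Type*} {H : SimpleGraph V} (hH : H.Connected) {C : Set V}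
    (hC : ∀ u ∈ C, ∀ v, H.Adj u v → v ∈ C) {u : V} (hu : u ∈ C) (v : V) : v ∈ C := by
  obtain ⟨w⟩ := hH.preconnected u v
  induction w with
  | nil => exact hu
  | cons h _ ih => exact ih (hC _ hu _ h)

/-- In a connected graph, a non-backtracking walk whose interior vertices have degree two is a path
or a cycle, unless the graph is a shorter cycle. -/
theorem isPathOrCycle_of_nonbacktracking {V : Type*} [Fintype V] {H : SimpleGraph V}
    (hH : H.Connected) {x : ℕ → V} {q : ℕ} (hadj : ∀ i < q, H.Adj (x i) (x (i + 1)))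
    (hnb : ∀ i, i + 2 ≤ q → x i ≠ x (i + 2))
    (hdeg : ∀ i, 0 < i → i < q → (H.neighborSet (x i)).ncard = 2)
    (hbig : q ≤ Fintype.card V ∨ ∃ v, (H.neighborSet v).ncard ≠ 2) : IsPathOrCycle H x q := by
  classical
  refine ⟨hadj, ?_⟩
  by_contra hcon
  push Not at hcon
  have hex : ∃ L, ∃ i, 0 < L ∧ i + L ≤ q ∧ x i = x (i + L) ∧ (i = 0 → i + L ≠ q) := by
    obtain ⟨i, j, hij, hj, h, hne⟩ := hcon
    exact ⟨j - i, i, by omega, by omega, by rwa [Nat.add_sub_cancel' hij.le],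
      by rwa [Nat.add_sub_cancel' hij.le]⟩
  -- Take a forbidden repetition with the smallest gap `L`. Every vertex on the resulting closed
  -- walk has degree two, so the walk is closed under adjacency and covers the whole connected
  -- graph.
  obtain ⟨i, hL, hiL, heq, hne⟩ := Nat.find_spec hex
  have hmin := fun m (hm : m < Nat.find hex) => Nat.find_min hex hm
  generalize Nat.find hex = L at hL hiL heq hne hmin
  have hL1 : L ≠ 1 := by
    rintro rfl
    exact (hadj i (by omega)).ne heq
  have hL2 : L ≠ 2 := by
    rintro rfl
    exact hnb i hiL heq
  have hend : x (i + 1) ≠ x (i + L - 1) := by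
    intro h
    exact hmin (L - 2) (by omega) ⟨i + 1, by omega, by omega,
      by rwa [show i + 1 + (L - 2) = i + L - 1 by omega], by omega⟩
  have hdegi : (H.neighborSet (x i)).ncard = 2 := by
    rcases Nat.eq_zero_or_pos i with rfl | hi
    · rw [heq]
      exact hdeg _ (by omega) (by have := hne rfl; omega)
    · exact hdeg _ hi (by omega)
  let C : Finset V := (Finset.range L).image fun m => x (i + m)
  have hmem : ∀ m, i ≤ m → m ≤ i + L → x m ∈ C := by
    intro m h1 h2
    rcases h2.eq_or_lt with rfl | h2
    · rw [← heq]
      exact Finset.mem_image.2 ⟨0, by simpa using hL, rfl⟩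
    · exact Finset.mem_image.2 ⟨m - i, by simp; omega, by rw [Nat.add_sub_cancel' h1]⟩
  have hclosed : ∀ u ∈ (C : Set V), ∀ v, H.Adj u v → v ∈ (C : Set V) := by
    intro u hu v huv
    obtain ⟨m, hm, rfl⟩ := Finset.mem_image.1 (Finset.mem_coe.1 hu)
    have hm' := Finset.mem_range.1 hm
    rcases Nat.eq_zero_or_pos m with rfl | hmpos
    · have h1 := hadj (i + L - 1) (by omega)
      rw [Nat.sub_add_cancel (by omega), ← heq] at h1
      rcases eq_or_eq_of_ncard_neighborSet hdegi (hadj i (by omega)) h1.symm hend huv with rfl | rfl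
      · exact hmem _ (by omega) (by omega)
      · exact hmem _ (by omega) (by omega)
    · have h1 := hadj (i + m - 1) (by omega)
      have h2 := hnb (i + m - 1) (by omega)
      rw [Nat.sub_add_cancel (by omega)] at h1
      rw [show i + m - 1 + 2 = i + m + 1 by omega] at h2
      rcases eq_or_eq_of_ncard_neighborSet (hdeg (i + m) (by omega) (by omega)) h1.symm
        (hadj (i + m) (by omega)) h2 huv with rfl | rfl
      · exact hmem _ (by omega) (by omega)
      · exact hmem _ (by omega) (by omega)
  have hall : ∀ v, v ∈ C := fun v =>
    mem_of_connected_of_closed hH hclosed (hmem i le_rfl (by omega)) v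
  rcases hbig with hbig | ⟨v, hv⟩
  · have h1 : Fintype.card V ≤ L := by
      rw [← Finset.card_univ, ← Finset.card_range L]
      exact (Finset.card_le_card fun v _ => hall v).trans Finset.card_image_le
    have : i ≠ 0 := fun h => hne h (by omega)
    omega
  · obtain ⟨m, hm, rfl⟩ := Finset.mem_image.1 (hall v)
    have hm' := Finset.mem_range.1 hm
    rcases Nat.eq_zero_or_pos m with rfl | hmpos
    · exact hv hdegi
    · exact hv (hdeg _ (by omega) (by omega))

/-- Before its first visit to `P` an orbit can be traced back uniquely, so a point is determined by
the time of that visit, with `t` possible values, and the point visited. -/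
theorem card_le_mul_card_of_iterate {D : Type*} [Fintype D] (F : D → D) (P : D → Prop)
    [DecidablePred P] (t : ℕ) (hinj : ∀ a b, ¬ P a → ¬ P b → F a = F b → a = b)
    (hhit : ∀ d, ∃ i < t, P (F^[i] d)) :
    Fintype.card D ≤ t * (Finset.univ.filter P).card := by
  have hback : ∀ i a b, (∀ j < i, ¬ P (F^[j] a)) → (∀ j < i, ¬ P (F^[j] b)) →
      F^[i] a = F^[i] b → a = b := by
    intro i
    induction i with
    | zero => exact fun a b _ _ h => h
    | succ i ih =>
      intro a b ha hb h
      rw [Function.iterate_succ_apply', Function.iterate_succ_apply'] at h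
      exact ih a b (fun j hj => ha j (by omega)) (fun j hj => hb j (by omega))
        (hinj _ _ (ha i (by omega)) (hb i (by omega)) h)
  have hhit' : ∀ d, ∃ i, P (F^[i] d) := fun d => (hhit d).imp fun _ h => h.2
  rw [← Finset.card_range t, ← Finset.card_product, ← Finset.card_univ]
  refine Finset.card_le_card_of_injOn (fun d => (Nat.find (hhit' d), F^[Nat.find (hhit' d)] d))
    (fun d _ => ?_) fun a _ b _ hab => ?_
  · obtain ⟨i, hi, hPi⟩ := hhit d
    simp only [Finset.coe_product, Set.mem_prod, Finset.mem_coe, Finset.mem_range,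
      Finset.mem_filter, Finset.mem_univ, true_and]
    exact ⟨(Nat.find_min' (hhit' d) hPi).trans_lt hi, Nat.find_spec (hhit' d)⟩
  · simp only [Prod.mk.injEq] at hab
    refine hback (Nat.find (hhit' a)) a b (fun j hj => Nat.find_min _ hj)
      (fun j hj => Nat.find_min (hhit' b) (hab.1 ▸ hj)) ?_
    rw [hab.2, hab.1]

/-- A connected graph of minimum degree at least two has a suspended path or cycle with `t + 1`
edges, or is a cycle with at most `t` vertices, or has few edges relative to its excess. -/
theorem exists_suspended_or_edges_le {V : Type*} [Fintype V] {H : SimpleGraph V}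
    (hH : H.Connected) (hmin : ∀ x, 2 ≤ (H.neighborSet x).ncard) (t : ℕ) :
    (∃ x, IsPathOrCycle H x (t + 1) ∧
      ∀ i, 0 < i → i < t + 1 → (H.neighborSet (x i)).ncard = 2) ∨
    (Fintype.card V ≤ t ∧ H.edgeSet.ncard = Fintype.card V) ∨
    (Fintype.card V ≤ H.edgeSet.ncard ∧
      H.edgeSet.ncard ≤ 3 * t * (H.edgeSet.ncard - Fintype.card V)) := by
  classical
  have hsum := sum_ncard_neighborSet H
  have hsplit : ∑ x, (H.neighborSet x).ncard
      = ∑ x, ((H.neighborSet x).ncard - 2) + 2 * Fintype.card V := by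
    rw [mul_comm, ← smul_eq_mul, ← Finset.card_univ, ← Finset.sum_const, ← Finset.sum_add_distrib]
    exact Finset.sum_congr rfl fun x _ => (Nat.sub_add_cancel (hmin x)).symm
  by_cases hbig : t + 1 ≤ Fintype.card V ∨ ∃ v, (H.neighborSet v).ncard ≠ 2
  swap
  · push Not at hbig
    refine Or.inr (Or.inl ⟨by omega, ?_⟩)
    simp only [hbig.2, Nat.sub_self, Finset.sum_const_zero, zero_add] at hsplit hsum
    simp at hsum
    omega
  by_cases hsusp : ∃ x, IsPathOrCycle H x (t + 1) ∧
      ∀ i, 0 < i → i < t + 1 → (H.neighborSet (x i)).ncard = 2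
  · exact Or.inl hsusp
  refine Or.inr (Or.inr ⟨by omega, ?_⟩)
  have hother : ∀ d : H.Dart, ∃ v, H.Adj d.fst v ∧ v ≠ d.snd := by
    intro d
    obtain ⟨v, hv, hne⟩ := Set.exists_ne_of_one_lt_ncard (hmin d.fst) d.snd
    exact ⟨v, hv, hne⟩
  choose o ho hone using hother
  -- `F` walks backwards without reversing. At a tail of degree two the continuation is forced, so
  -- `F` is injective there; an orbit avoiding other tails for `t` steps would trace a suspended
  -- path or cycle with `t + 1` edges.
  let F : H.Dart → H.Dart := fun d => ⟨(o d, d.fst), (ho d).symm⟩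
  have key := card_le_mul_card_of_iterate F (fun d => (H.neighborSet d.fst).ncard ≠ 2) t
    (by
      intro a b ha hb hab
      simp only [not_not] at ha hb
      have h1 : o a = o b := congrArg (fun d : H.Dart => d.fst) hab
      have h2 : a.fst = b.fst := congrArg (fun d : H.Dart => d.snd) hab
      have h3 : a.snd = b.snd := by
        rcases eq_or_eq_of_ncard_neighborSet ha (ho a) a.adj (hone a)
          (show H.Adj a.fst b.snd from h2 ▸ b.adj) with h | h
        · exact absurd (h.trans h1).symm (hone b)
        · exact h.symm
      exact Dart.ext _ _ (Prod.ext h2 h3))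
    (by
      intro d
      by_contra! hno
      let x : ℕ → V := fun i => (F^[i] d).snd
      have hx : ∀ i, x (i + 1) = (F^[i] d).fst := by
        intro i
        simp only [x, Function.iterate_succ_apply']
        rfl
      have hdeg : ∀ i, 0 < i → i < t + 1 → (H.neighborSet (x i)).ncard = 2 := by
        intro i hi hit
        obtain ⟨i, rfl⟩ := Nat.exists_eq_add_of_le' hi
        rw [hx]
        exact hno i (by omega)
      refine hsusp ⟨x, isPathOrCycle_of_nonbacktracking hH ?_ ?_ hdeg hbig, hdeg⟩
      · intro i _
        rw [hx]
        exact (F^[i] d).adj.symm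
      · intro i _ h
        rw [hx, Function.iterate_succ_apply'] at h
        exact hone _ h.symm)
  rw [dart_card_eq_twice_card_edges, ← ncard_edgeSet_eq_card] at key
  -- A vertex of degree `δ ≥ 3` is the tail of `δ ≤ 3 * (δ - 2)` darts, and the sum of `δ - 2` is
  -- twice the excess.
  have hfib : (Finset.univ.filter fun d : H.Dart => (H.neighborSet d.fst).ncard ≠ 2).card
      ≤ 3 * ∑ x, ((H.neighborSet x).ncard - 2) := by
    rw [Finset.card_eq_sum_card_fiberwise (f := fun d : H.Dart => d.fst) (t := Finset.univ)
      (fun _ _ => Finset.mem_coe.2 (Finset.mem_univ _)), Finset.mul_sum]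
    refine Finset.sum_le_sum fun v _ => ?_
    by_cases hv : (H.neighborSet v).ncard = 2
    · rw [Finset.card_eq_zero.2]
      · exact Nat.zero_le _
      · ext d
        simp only [Finset.mem_filter, Finset.mem_univ, true_and, Finset.notMem_empty, iff_false,
          not_and]
        rintro h rfl
        exact h hv
    · have h1 : ((Finset.univ.filter fun d : H.Dart => (H.neighborSet d.fst).ncard ≠ 2).filter
          fun d => d.fst = v).card ≤ (H.neighborSet v).ncard := by
        rw [ncard_neighborSet_eq_degree, ← H.dart_fst_fiber_card_eq_degree]
        exact Finset.card_le_card (Finset.filter_subset_filter _ (Finset.filter_subset _ _))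
      have := hmin v
      omega
  have h2 := key.trans (Nat.mul_le_mul_left t hfib)
  have h3 : ∑ x, ((H.neighborSet x).ncard - 2) = 2 * (H.edgeSet.ncard - Fintype.card V) := by omega
  rw [h3] at h2
  have h4 : t * (3 * (2 * (H.edgeSet.ncard - Fintype.card V)))
      = 2 * (3 * t * (H.edgeSet.ncard - Fintype.card V)) := by ring
  omega

/-! ### Shortening a suspended path or cycle by one vertex -/

section Suppress

variable {V : Type*} {H : SimpleGraph V} {x : ℕ → V} {p : ℕ}

/-- The graph obtained from `H` by replacing the vertex `x 1` of a suspended path or cycle by an edge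
between its neighbours. -/
abbrev suppress (H : SimpleGraph V) (x : ℕ → V) : SimpleGraph ({x 1}ᶜ : Set V) :=
  (H ⊔ edge (x 0) (x 2)).induce {x 1}ᶜ

theorem IsPathOrCycle.ne {q i j : ℕ} (hx : IsPathOrCycle H x q) (hij : i < j) (hj : j ≤ q)
    (h : i ≠ 0 ∨ j ≠ q) : x i ≠ x j := by
  intro heq
  have := hx.inj i j hij hj heq
  omega

theorem IsPathOrCycle.eq_or_eq_of_adj (hx : IsPathOrCycle H x (p + 1)) (hp : 3 ≤ p)
    (hdeg : ∀ i, 0 < i → i < p + 1 → (H.neighborSet (x i)).ncard = 2) {i : ℕ} (hi : i < p) {v : V}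
    (h : H.Adj (x (i + 1)) v) : v = x i ∨ v = x (i + 2) :=
  eq_or_eq_of_ncard_neighborSet (hdeg _ (by omega) (by omega)) (hx.adj i (by omega)).symm
    (hx.adj (i + 1) (by omega)) (hx.ne (by omega) (by omega) (by omega)) h

/-- Moving `x 1` onto `x 0` turns every edge of `H` into a pair still joined by a walk. -/
theorem suppress_connected (hH : H.Connected) (hx : IsPathOrCycle H x (p + 1)) (hp : 3 ≤ p)
    (hdeg : ∀ i, 0 < i → i < p + 1 → (H.neighborSet (x i)).ncard = 2) :
    (suppress H x).Connected := by
  classical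
  have h01 : x 0 ≠ x 1 := hx.ne (by omega) (by omega) (by omega)
  have h02 : x 0 ≠ x 2 := hx.ne (by omega) (by omega) (by omega)
  have h12 : x 1 ≠ x 2 := hx.ne (by omega) (by omega) (by omega)
  let g : V → ({x 1}ᶜ : Set V) := fun v => if h : v = x 1 then ⟨x 0, h01⟩ else ⟨v, h⟩
  have hg1 : g (x 1) = ⟨x 0, h01⟩ := by simp [g]
  have hg : ∀ v (h : v ≠ x 1), g v = ⟨v, h⟩ := fun v h => by simp [g, h]
  have hnew : (suppress H x).Adj ⟨x 0, h01⟩ ⟨x 2, h12.symm⟩ := by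
    simp [suppress, sup_adj, edge_adj, h02]
  have hstep1 : ∀ v, H.Adj (x 1) v → (suppress H x).Reachable (g (x 1)) (g v) := by
    intro v hv
    rcases hx.eq_or_eq_of_adj hp hdeg (i := 0) (by omega) hv with rfl | rfl
    · rw [hg1, hg _ h01]
    · rw [hg1, hg _ h12.symm]
      exact hnew.reachable
  have hstep : ∀ u v, H.Adj u v → (suppress H x).Reachable (g u) (g v) := by
    intro u v huv
    by_cases hu : u = x 1
    · subst hu
      exact hstep1 v huv
    by_cases hv : v = x 1
    · subst hv
      exact (hstep1 u huv.symm).symm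
    rw [hg u hu, hg v hv]
    exact Adj.reachable (Or.inl huv : (H ⊔ edge (x 0) (x 2)).Adj u v)
  rw [connected_iff]
  refine ⟨fun a b => ?_, ⟨⟨x 0, h01⟩⟩⟩
  obtain ⟨w⟩ := hH.preconnected (a : V) b
  have : ∀ {u v : V}, H.Walk u v → (suppress H x).Reachable (g u) (g v) := by
    intro u v w
    induction w with
    | nil => exact Reachable.refl _
    | cons h _ ih => exact (hstep _ _ h).trans ih
  have := this w
  rwa [hg _ a.2, hg _ b.2] at this

/-- Two edges go and one comes, with one vertex lost, so the excess is unchanged. The bound `3 ≤ p`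
excludes a triangle, in which the new edge would already be present. -/
theorem ncard_edgeSet_suppress [Fintype V] (hx : IsPathOrCycle H x (p + 1)) (hp : 3 ≤ p)
    (hdeg : ∀ i, 0 < i → i < p + 1 → (H.neighborSet (x i)).ncard = 2) :
    (suppress H x).edgeSet.ncard + 1 = H.edgeSet.ncard := by
  classical
  have h02 : x 0 ≠ x 2 := hx.ne (by omega) (by omega) (by omega)
  have hn : ¬ H.Adj (x 0) (x 2) := by
    intro h
    rcases hx.eq_or_eq_of_adj hp hdeg (i := 1) (by omega) h.symm with h | h
    · exact hx.ne (i := 0) (j := 1) (by omega) (by omega) (by omega) h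
    · exact hx.ne (i := 0) (j := 3) (by omega) (by omega) (by omega) h
  have h1 : (suppress H x).edgeSet.ncard + _ = _ :=
    ncard_edgeSet_induce_compl_singleton (H ⊔ edge (x 0) (x 2)) (x 1)
  have h2 : (H ⊔ edge (x 0) (x 2)).neighborSet (x 1) = H.neighborSet (x 1) := by
    ext v
    have h01 : x 0 ≠ x 1 := hx.ne (by omega) (by omega) (by omega)
    have h12 : x 1 ≠ x 2 := hx.ne (by omega) (by omega) (by omega)
    simp only [mem_neighborSet, sup_adj, edge_adj]
    simp [h01.symm, h12]
  have h3 := H.card_edgeFinset_sup_edge hn h02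
  rw [← ncard_edgeSet_eq_card, ← ncard_edgeSet_eq_card] at h3
  rw [h2, h3, hdeg 1 (by omega) (by omega)] at h1
  omega

/-- A copy of the suppressed graph extends to a copy of the graph when the image of the suspended
path or cycle can be lengthened by one. -/
theorem isContained_of_suppress {M : Type*} {R : SimpleGraph M}
    (hx : IsPathOrCycle H x (p + 1)) (hp : 3 ≤ p)
    (hdeg : ∀ i, 0 < i → i < p + 1 → (H.neighborSet (x i)).ncard = 2)
    (f : ({x 1}ᶜ : Set V) → M) (hf : Function.Injective f)
    (hfadj : ∀ u v, (suppress H x).Adj u v → R.Adj (f u) (f v))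
    (hext : ∀ z, IsPathOrCycle R z p → (∀ i ≤ p, z i ∈ Set.range f) →
      ∃ w, IsPathOrCycle R w (p + 1) ∧ w 0 = z 0 ∧ w (p + 1) = z p ∧
        ∀ m ≤ p + 1, w m ∉ Set.range f ∨ ∃ j ≤ p, w m = z j) :
    H.IsContained R := by
  classical
  have h01 : x 0 ≠ x 1 := hx.ne (by omega) (by omega) (by omega)
  have h02 : x 0 ≠ x 2 := hx.ne (by omega) (by omega) (by omega)
  have hne1 : ∀ i, 1 < i → i ≤ p + 1 → x i ≠ x 1 := fun i h h' =>
    (hx.ne h h' (by omega)).symm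
  -- The value at `x 1` is a dummy, never used for the final embedding.
  let f' : V → M := fun v => if h : v = x 1 then f ⟨x 0, h01⟩ else f ⟨v, h⟩
  have hf'eq : ∀ v (h : v ≠ x 1), f' v = f ⟨v, h⟩ := fun v h => by simp [f', h]
  have hf'inj : ∀ u v, u ≠ x 1 → v ≠ x 1 → f' u = f' v → u = v := by
    intro u v hu hv h
    rw [hf'eq u hu, hf'eq v hv] at h
    exact congrArg Subtype.val (hf h)
  have hf'adj : ∀ u v, u ≠ x 1 → v ≠ x 1 → (H ⊔ edge (x 0) (x 2)).Adj u v →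
      R.Adj (f' u) (f' v) := by
    intro u v hu hv h
    rw [hf'eq u hu, hf'eq v hv]
    exact hfadj ⟨u, hu⟩ ⟨v, hv⟩ h
  -- Indexes the shortened path in terms of `x`, skipping `x 1`.
  let τ : ℕ → ℕ := fun i => if i = 0 then 0 else i + 1
  have hτ : ∀ i, i ≤ p → x (τ i) ≠ x 1 := by
    intro i hi
    rcases Nat.eq_zero_or_pos i with rfl | h
    · exact h01
    · simpa [τ, h.ne'] using hne1 (i + 1) (by omega) (by omega)
  have hz : IsPathOrCycle R (fun i => f' (x (τ i))) p := by
    refine ⟨fun i hi => hf'adj _ _ (hτ i hi.le) (hτ (i + 1) hi) ?_, fun i j hij hj h => ?_⟩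
    · rcases Nat.eq_zero_or_pos i with rfl | h
      · simp [τ, edge_adj, h02]
      · simpa [τ, h.ne'] using Or.inl (hx.adj (i + 1) (by omega))
    · have h := hf'inj _ _ (hτ i (by omega)) (hτ j hj) h
      have hτij : τ i < τ j ∧ τ j ≤ p + 1 ∧ (i = 0 ∨ 0 < τ i) ∧ τ j ≤ j + 1 := by
        simp only [τ]; split_ifs <;> omega
      have := hx.inj (τ i) (τ j) hτij.1 hτij.2.1 h
      omega
  obtain ⟨w, hw, hw0, hwp, hwU⟩ := hext _ hz fun i hi => ⟨⟨_, hτ i hi⟩, (hf'eq _ (hτ i hi)).symm⟩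
  have hw0' : w 0 = f' (x 0) := hw0
  have hwp' : w (p + 1) = f' (x (p + 1)) := by
    rw [hwp]; simp [τ, show p ≠ 0 by omega]
  let g : V → M := fun v =>
    if h : ∃ i, 0 < i ∧ i ≤ p ∧ x i = v then w h.choose else f' v
  have hgin : ∀ i, 0 < i → i ≤ p → g (x i) = w i := by
    intro i h0 hi
    have hex : ∃ j, 0 < j ∧ j ≤ p ∧ x j = x i := ⟨i, h0, hi, rfl⟩
    have hspec := hex.choose_spec
    have : hex.choose = i := by
      rcases lt_trichotomy hex.choose i with h | h | h
      · exact absurd hspec.2.2 (hx.ne h (by omega) (by omega))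
      · exact h
      · exact absurd hspec.2.2.symm (hx.ne h (by omega) (by omega))
    simp only [g, dif_pos hex, this]
  have hgout : ∀ v, (¬ ∃ i, 0 < i ∧ i ≤ p ∧ x i = v) → g v = f' v := fun v h => by
    simp only [g, dif_neg h]
  have hgx : ∀ i, i ≤ p + 1 → g (x i) = w i := by
    intro i hi
    rcases Nat.eq_zero_or_pos i with rfl | h0
    · rw [hw0', hgout]
      rintro ⟨j, h0, hj, h⟩
      exact hx.ne h0 (by omega) (by omega) h.symm
    · rcases hi.eq_or_lt with rfl | hi
      · rw [hwp', hgout]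
        rintro ⟨j, h0, hj, h⟩
        exact hx.ne (i := j) (j := p + 1) (by omega) (by omega) (by omega) h
      · exact hgin i h0 (by omega)
  have hcross : ∀ i v, 0 < i → i ≤ p → (¬ ∃ j, 0 < j ∧ j ≤ p ∧ x j = v) → w i ≠ g v := by
    intro i v h0 hi hv heq
    have hv1 : v ≠ x 1 := fun h => hv ⟨1, by omega, by omega, h.symm⟩
    have hgv := hgout v hv
    have hran : w i ∈ Set.range f := ⟨⟨v, hv1⟩, by rw [heq, hgv, hf'eq v hv1]⟩
    -- A vertex of `w` already in the image lies on `z`, so `v` lies on `x`. It is not interior by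
    -- assumption, and as an endpoint it would make `w` repeat a vertex.
    obtain ⟨j, hj, hwj⟩ := (hwU i (by omega)).resolve_left (not_not.2 hran)
    have hvx : v = x (τ j) := by
      refine hf'inj _ _ hv1 (hτ j hj) ?_
      rw [← hgv, ← heq, hwj]
    rcases Nat.eq_zero_or_pos j with rfl | hj0
    · have : w i = w 0 := by rw [heq, hvx]; exact hgx 0 (by omega)
      exact hw.ne h0 (by omega) (by omega) this.symm
    · have hτj : τ j = j + 1 := by simp [τ, hj0.ne']
      rw [hτj] at hvx
      rcases hj.eq_or_lt with rfl | hj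
      · have : w i = w (j + 1) := by rw [heq, hvx]; exact hgx _ le_rfl
        exact hw.ne (by omega) le_rfl (by omega) this
      · exact hv ⟨j + 1, by omega, by omega, hvx.symm⟩
  have hadj1 : ∀ i v, 0 < i → i ≤ p → H.Adj (x i) v → R.Adj (g (x i)) (g v) := by
    intro i v h0 hi h
    obtain ⟨i, rfl⟩ := Nat.exists_eq_add_of_le' h0
    rcases hx.eq_or_eq_of_adj hp hdeg (by omega) h with rfl | rfl
    · rw [hgx _ (by omega), hgx _ (by omega)]
      exact (hw.adj i (by omega)).symm
    · rw [hgx _ (by omega), hgx _ (by omega)]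
      exact hw.adj (i + 1) (by omega)
  refine isContained_of_injective g (fun u v huv => ?_) fun u v huv => ?_
  · by_cases hu : ∃ i, 0 < i ∧ i ≤ p ∧ x i = u <;> by_cases hv : ∃ i, 0 < i ∧ i ≤ p ∧ x i = v
    · obtain ⟨i, hi0, hi, rfl⟩ := hu
      obtain ⟨j, hj0, hj, rfl⟩ := hv
      rw [hgin i hi0 hi, hgin j hj0 hj] at huv
      rcases lt_trichotomy i j with h | rfl | h
      · exact absurd huv (hw.ne h (by omega) (by omega))
      · rfl
      · exact absurd huv.symm (hw.ne h (by omega) (by omega))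
    · obtain ⟨i, hi0, hi, rfl⟩ := hu
      rw [hgin i hi0 hi] at huv
      exact absurd huv (hcross i v hi0 hi hv)
    · obtain ⟨i, hi0, hi, rfl⟩ := hv
      rw [hgin i hi0 hi] at huv
      exact absurd huv.symm (hcross i u hi0 hi hu)
    · rw [hgout u hu, hgout v hv] at huv
      exact hf'inj u v (fun h => hu ⟨1, by omega, by omega, h.symm⟩)
        (fun h => hv ⟨1, by omega, by omega, h.symm⟩) huv
  · by_cases hu : ∃ i, 0 < i ∧ i ≤ p ∧ x i = u
    · obtain ⟨i, hi0, hi, rfl⟩ := hu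
      exact hadj1 i v hi0 hi huv
    by_cases hv : ∃ i, 0 < i ∧ i ≤ p ∧ x i = v
    · obtain ⟨i, hi0, hi, rfl⟩ := hv
      exact (hadj1 i u hi0 hi huv.symm).symm
    rw [hgout u hu, hgout v hv]
    exact hf'adj u v (fun h => hu ⟨1, by omega, by omega, h.symm⟩)
      (fun h => hv ⟨1, by omega, by omega, h.symm⟩) (Or.inl huv)

end Suppress

/-! ### Reduction to cores -/

/-- Greedy embedding: leaves are attached one at a time, suspended paths and cycles are built up one
vertex at a time, and the remaining cores are embedded by assumption. -/
theorem isContained_of_host.{u} {V : Type u} [Fintype V] {M : Type*} {R : SimpleGraph M}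
    {n l p : ℕ} (hp : 3 ≤ p)
    (hleaf : ∀ U : Finset M, U.card < n → ∀ x ∈ U, ∃ y ∉ U, R.Adj x y)
    (hext : ∀ U : Finset M, U.card < n → ∀ z, IsPathOrCycle R z p → (∀ i ≤ p, z i ∈ U) →
      ∃ w, IsPathOrCycle R w (p + 1) ∧ w 0 = z 0 ∧ w (p + 1) = z p ∧
        ∀ m ≤ p + 1, w m ∉ U ∨ ∃ j ≤ p, w m = z j)
    (hcore : ∀ (W : Type u) [Fintype W] (H : SimpleGraph W),
      (Fintype.card W ≤ p ∧ H.edgeSet.ncard ≤ Fintype.card W) ∨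
      (Fintype.card W ≤ H.edgeSet.ncard ∧ H.edgeSet.ncard ≤ 3 * p * l) → H.IsContained R)
    (H : SimpleGraph V) (hH : H.Connected) (hV : Fintype.card V ≤ n)
    (he : H.edgeSet.ncard ≤ Fintype.card V + l) : H.IsContained R := by
  classical
  induction hv : Fintype.card V generalizing V with
  | zero =>
    have := Fintype.card_eq_zero_iff.1 hv
    exact isContained_of_injective isEmptyElim (fun a => isEmptyElim a) fun a => isEmptyElim a
  | succ v ih =>
    rcases Nat.eq_zero_or_pos v with rfl | hvpos
    -- A single vertex has degree zero, so neither reduction applies; it counts as a core.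
    · refine hcore V H (Or.inl ⟨by omega, ?_⟩)
      have : Subsingleton V := Fintype.card_le_one_iff_subsingleton.1 hv.le
      have : H.edgeSet = ∅ := by
        rw [edgeSet_eq_empty]
        ext a b
        simpa using fun h : H.Adj a b => h.ne (Subsingleton.elim a b)
      simp [this]
    have : Nontrivial V := Fintype.one_lt_card_iff_nontrivial.1 (by omega)
    have hrange : ∀ (x : V) (f : ({x}ᶜ : Set V) → M), Function.Injective f →
        (Finset.univ.image f).card < n := by
      intro x f hf
      have := card_compl_singleton x
      rw [Finset.card_image_of_injective _ hf, Finset.card_univ]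
      omega
    have hpos : ∀ x, 1 ≤ (H.neighborSet x).ncard := by
      intro x
      rw [ncard_neighborSet_eq_degree]
      exact hH.preconnected.degree_pos_of_nontrivial x
    by_cases hmin : ∀ x, 2 ≤ (H.neighborSet x).ncard
    · rcases exists_suspended_or_edges_le hH hmin p with ⟨x, hx, hdeg⟩ | h | h
      · have hc := card_compl_singleton (x 1)
        have hes := ncard_edgeSet_suppress hx hp hdeg
        obtain ⟨f⟩ := ih (suppress H x) (suppress_connected hH hx hp hdeg) (by omega) (by omega)
          (by omega)
        refine isContained_of_suppress hx hp hdeg f f.injective (fun u v h => f.toHom.map_adj h) ?_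
        intro z hz hzf
        obtain ⟨w, hw⟩ := hext (Finset.univ.image f) (hrange _ f f.injective) z hz
          fun i hi => by simpa using hzf i hi
        exact ⟨w, by simpa using hw⟩
      · exact hcore V H (Or.inl ⟨h.1, h.2.le⟩)
      · refine hcore V H (Or.inr ⟨h.1, h.2.trans (Nat.mul_le_mul_left _ (by omega))⟩)
    · push Not at hmin
      obtain ⟨x, hx⟩ := hmin
      have hx1 : (H.neighborSet x).ncard = 1 := by have := hpos x; omega
      have hc := card_compl_singleton x
      have hes := ncard_edgeSet_induce_compl_singleton H x
      obtain ⟨f⟩ := ih (H.induce {x}ᶜ)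
        (hH.induce_compl_singleton_of_degree_eq_one (by rwa [← ncard_neighborSet_eq_degree]))
        (by omega) (by omega) (by omega)
      obtain ⟨a, ha⟩ := Set.ncard_eq_one.1 hx1
      have hxa : H.Adj x a := by
        have : a ∈ H.neighborSet x := by rw [ha]; rfl
        exact this
      obtain ⟨y, hy, hadj⟩ := hleaf (Finset.univ.image f) (hrange _ f f.injective)
        (f ⟨a, hxa.ne'⟩) (Finset.mem_image_of_mem _ (Finset.mem_univ _))
      refine isContained_of_induce_compl_singleton x f f.injective (fun u v h => f.toHom.map_adj h)
        y (fun u h => hy (h ▸ Finset.mem_image_of_mem _ (Finset.mem_univ _))) fun u hu => ?_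
      have : (u : V) = a := by
        have : (u : V) ∈ H.neighborSet x := hu
        rwa [ha] at this
      have : u = ⟨a, hxa.ne'⟩ := Subtype.ext this
      rw [this]
      exact hadj.symm

/-! ### The two cases of blue degree -/

/-- The case of a vertex with many non-neighbours, in whose non-neighbourhood the graph is found. -/
theorem isContained_of_compl_degree_lt {V : Type*} [Fintype V] {M : Type*} [Fintype M]
    {R : SimpleGraph M} {n k l : ℕ} (hk : 1 ≤ k) (hR : CoBookFree k R)
    (hdeg : ∀ u, ∀ T : Finset M, (∀ w ∈ T, Rᶜ.Adj u w) → T.card < k)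
    (hM : n + k ≤ Fintype.card M + 1) (hn : 3 * k ^ 2 ≤ n) (hl : 9 * k ^ 2 * l ≤ n)
    (G : SimpleGraph V) (hG : G.Connected) (hV : Fintype.card V ≤ n)
    (he : G.edgeSet.ncard ≤ Fintype.card V + l) : G.IsContained R := by
  classical
  refine isContained_of_host (n := n) (l := l) (p := 3 * k) (by omega) ?_ ?_ ?_ G hG hV he
  · intro U hU x hx
    by_contra! hno
    have h1 := hdeg x (Finset.univ \ U) fun w hw => by
      have hw := (Finset.mem_sdiff.1 hw).2
      exact (compl_adj _ _ _).2 ⟨fun h => hw (h ▸ hx), hno w hw⟩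
    have h2 := Finset.card_sdiff_add_card_eq_card (Finset.subset_univ U)
    rw [Finset.card_univ] at h2
    omega
  · intro U hU z hz hzU
    obtain ⟨y, hy⟩ : ∃ y, y ∉ U := by
      by_contra! hall
      have : Fintype.card M ≤ U.card := by
        rw [← Finset.card_univ]; exact Finset.card_le_card fun y _ => hall y
      omega
    have hzy : ∀ i ≤ 3 * k, z i ≠ y := fun i hi h => hy (h ▸ hzU i hi)
    have hinj : Set.InjOn z (Finset.range (3 * k)) := by
      intro i hi j hj h
      have hi := Finset.mem_range.1 hi
      have hj := Finset.mem_range.1 hj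
      rcases lt_trichotomy i j with h' | h' | h'
      · exact absurd h (hz.ne h' (by omega) (by omega))
      · exact h'
      · exact absurd h.symm (hz.ne h' (by omega) (by omega))
    -- Any unused `y` misses fewer than `k` of the `3k` path vertices, so it has more than `2k` red
    -- neighbours there and can be absorbed.
    have h1 := hdeg y (((Finset.range (3 * k)).filter fun i => ¬ R.Adj y (z i)).image z) (by
      intro w hw
      obtain ⟨i, hi, rfl⟩ := Finset.mem_image.1 hw
      obtain ⟨hi, hi'⟩ := Finset.mem_filter.1 hi
      exact (compl_adj _ _ _).2 ⟨(hzy i (Finset.mem_range.1 hi).le).symm, hi'⟩)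
    rw [Finset.card_image_of_injOn (hinj.mono (Finset.coe_subset.2 (Finset.filter_subset _ _)))] at h1
    have h2 := Finset.card_filter_add_card_filter_not (s := Finset.range (3 * k))
      (fun i => R.Adj y (z i))
    rw [Finset.card_range] at h2
    obtain ⟨w, hw, h0, hp, hwU⟩ := hz.absorb hR hzy
      ((Finset.range (3 * k)).filter fun i => R.Adj y (z i))
      (fun i hi => ⟨Finset.mem_range.1 (Finset.mem_filter.1 hi).1, (Finset.mem_filter.1 hi).2⟩)
      (by omega)
    exact ⟨w, hw, h0, hp, fun m hm => (hwU m hm).imp_left fun h => by rwa [h]⟩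
  · intro W _ H hW
    have hkW : k * Fintype.card W ≤ n := by
      rcases hW with ⟨h, -⟩ | ⟨h, h'⟩
      · exact (Nat.mul_le_mul_left k h).trans (by nlinarith)
      · exact (Nat.mul_le_mul_left k (h.trans h')).trans (by nlinarith)
    obtain ⟨T, -, hTc, hT⟩ := exists_clique_of_sparse_compl (R := R) (k := k) hk (Fintype.card W)
      Finset.univ (fun x _ T _ hT => hdeg x T hT) (by rw [Finset.card_univ]; omega)
    exact isContained_of_isClique hT hTc.ge

theorem CoBookFree.isContained {V : Type*} [Fintype V] {M : Type*} [Fintype M]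
    {R : SimpleGraph M} {n k l : ℕ} (hk : 1 ≤ k) (hR : CoBookFree k R)
    (hM : Fintype.card M = 2 * n + k - 2) (hn : 6 * k ^ 3 ≤ n)
    (hl : (18 * k ^ 2 + 23 * k + 6) * l ≤ 2 * n)
    (G : SimpleGraph V) (hG : G.Connected) (hV : Fintype.card V = n)
    (he : G.edgeSet.ncard ≤ n + l) : G.IsContained R := by
  classical
  have hk2 : k ^ 2 ≤ k ^ 3 := Nat.pow_le_pow_right hk (by omega)
  have hk1 : k ≤ k ^ 2 := Nat.le_self_pow (by omega) k
  by_contra hno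
  by_cases hdeg : ∃ u, ∃ S : Finset M, (∀ w ∈ S, Rᶜ.Adj u w) ∧ n + k ≤ S.card + 1
  · obtain ⟨u, S, hS, hc⟩ := hdeg
    -- Inside the blue neighbourhood of `u`, a vertex with `k` blue neighbours would form a blue
    -- book with `u`.
    refine hno (IsContained.trans (B := R.induce (S : Set M)) ?_
      ⟨(Embedding.induce (S : Set M)).toCopy⟩)
    refine isContained_of_compl_degree_lt (n := n) (l := l) hk (hR.induce _) ?_
      (by simpa using hc) (by omega) (by nlinarith) G hG hV.le (by omega)
    intro x T hT
    have := hR u x (hS x x.2) (T.map (Function.Embedding.subtype _)) (by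
      intro w hw
      obtain ⟨w', hw', rfl⟩ := Finset.mem_map.1 hw
      exact ⟨hS w' w'.2, compl_adj_of_induce (hT w' hw')⟩)
    simpa using this
  push Not at hdeg
  refine hno (isContained_of_host (n := n) (l := l) (p := 3 * k) (by omega) ?_ ?_ ?_ G hG hV.le
    (by omega))
  · intro U hU x hx
    by_contra! hall
    have h1 := hdeg x (Finset.univ \ U) fun w hw => by
      have hw := (Finset.mem_sdiff.1 hw).2
      exact (compl_adj _ _ _).2 ⟨fun h => hw (h ▸ hx), hall w hw⟩
    have h2 := Finset.card_sdiff_add_card_eq_card (Finset.subset_univ U)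
    rw [Finset.card_univ] at h2
    omega
  · intro U hU z hz hzU
    by_contra hcon
    have hinj : Set.InjOn z (Finset.range (3 * k)) := by
      intro i hi j hj h
      have hi := Finset.mem_range.1 hi
      have hj := Finset.mem_range.1 hj
      rcases lt_trichotomy i j with h' | h' | h'
      · exact absurd h (hz.ne h' (by omega) (by omega))
      · exact h'
      · exact absurd h.symm (hz.ne h' (by omega) (by omega))
    have hzy : ∀ y ∉ U, ∀ i ≤ 3 * k, z i ≠ y := fun y hy i hi h => hy (h ▸ hzU i hi)
    have hfew : ∀ y ∉ U, ((Finset.range (3 * k)).filter fun i => R.Adj y (z i)).card ≤ k := by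
      intro y hy
      by_contra! hlt
      obtain ⟨w, hw, h0, hp, hwU⟩ := hz.absorb hR (hzy y hy) _
        (fun i hi => ⟨Finset.mem_range.1 (Finset.mem_filter.1 hi).1, (Finset.mem_filter.1 hi).2⟩) hlt
      exact hcon ⟨w, hw, h0, hp, fun m hm => (hwU m hm).imp_left fun h => by rwa [h]⟩
    refine hno (isContained_of_isClique (T := Finset.univ \ U) ?_ ?_)
    · intro a ha b hb hab
      have ha' := (Finset.mem_sdiff.1 (Finset.mem_coe.1 ha)).2
      have hb' := (Finset.mem_sdiff.1 (Finset.mem_coe.1 hb)).2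
      by_contra hR'
      -- This is where `p = 3 * k` comes from: removing at most `k` red neighbours of each of `a`
      -- and `b` leaves at least `k` common blue ones, the pages of a book.
      set J := (Finset.range (3 * k)).filter fun i => ¬ R.Adj a (z i) ∧ ¬ R.Adj b (z i) with hJ
      have h1 := hR a b ((compl_adj _ _ _).2 ⟨hab, hR'⟩) (J.image z) (by
        intro w hw
        obtain ⟨i, hi, rfl⟩ := Finset.mem_image.1 hw
        obtain ⟨hi, hia, hib⟩ := Finset.mem_filter.1 hi
        have hi := (Finset.mem_range.1 hi).le
        exact ⟨(compl_adj _ _ _).2 ⟨(hzy a ha' i hi).symm, hia⟩,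
          (compl_adj _ _ _).2 ⟨(hzy b hb' i hi).symm, hib⟩⟩)
      rw [Finset.card_image_of_injOn
        (hinj.mono (Finset.coe_subset.2 (Finset.filter_subset _ _))), ← hJ] at h1
      have h2 : Finset.range (3 * k) ⊆ ((Finset.range (3 * k)).filter fun i => R.Adj a (z i)) ∪
          ((Finset.range (3 * k)).filter fun i => R.Adj b (z i)) ∪ J := by
        intro i hi
        simp only [hJ, Finset.mem_union, Finset.mem_filter, hi, true_and]
        tauto
      have h3 := Finset.card_le_card h2
      have h4 := Finset.card_union_le (((Finset.range (3 * k)).filter fun i => R.Adj a (z i)) ∪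
          ((Finset.range (3 * k)).filter fun i => R.Adj b (z i))) J
      have h5 := Finset.card_union_le ((Finset.range (3 * k)).filter fun i => R.Adj a (z i))
          ((Finset.range (3 * k)).filter fun i => R.Adj b (z i))
      have h6 := hfew a ha'
      have h7 := hfew b hb'
      rw [Finset.card_range] at h3
      omega
    · have h2 := Finset.card_sdiff_add_card_eq_card (Finset.subset_univ U)
      rw [Finset.card_univ] at h2
      omega
  · intro W _ H hW
    refine hR.isContained_of_card_add_le hk H ?_
    rw [hM]
    rcases hW with ⟨h, h'⟩ | ⟨h, h'⟩
    · have h1 : 2 * k * H.edgeSet.ncard ≤ 2 * k * (3 * k) := Nat.mul_le_mul_left _ (h'.trans h)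
      have h2 : 2 * k * (3 * k) = 6 * k ^ 2 := by ring
      omega
    · have h1 : 2 * k * H.edgeSet.ncard ≤ 2 * k * (3 * (3 * k) * l) := Nat.mul_le_mul_left _ h'
      have h2 : 2 * k * (3 * (3 * k) * l) = 18 * (k ^ 2 * l) := by ring
      have h3 : 3 * (3 * k) * l = 9 * (k * l) := by ring
      have h4 : (18 * k ^ 2 + 23 * k + 6) * l = 18 * (k ^ 2 * l) + 23 * (k * l) + 6 * l := by ring
      -- The core needs at most `9kl + 18k²l` vertices. The spare `14kl + 6l` in `hl` covers the `-
      -- 2` in the host size when `l > 0`; when `l = 0` the core bound vanishes.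
      rcases Nat.eq_zero_or_pos l with rfl | hl0
      · simp only [mul_zero] at *
        omega
      · omega

end SparseBook

theorem lemma3p2 {V : Type*} [Fintype V] (G : SimpleGraph V) [Fintype G.edgeSet] (k n : ℕ)
    (hk : 1 ≤ k) (hn : 6 * k ^ 3 ≤ n) (hG : G.Connected) (hcard : Fintype.card V = n)
    (hedges : (G.edgeFinset.card : ℝ) ≤
      (n : ℝ) * (1 + 1 / (9 * (k : ℝ) ^ 2 + 23 * (k : ℝ) / 2 + 3))) :
    SparseBook.ramseyNumber G (SparseBook.book k) ≤ ((2 * n + k - 2 : ℕ) : ℕ∞) := by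
  have hk3 : 1 ≤ k ^ 3 := Nat.one_le_pow _ _ hk
  refine iInf₂_le (2 * n + k - 2) ⟨by omega, fun R => ?_⟩
  by_contra hcon
  rw [not_or] at hcon
  -- The excess is truncated at zero, which covers trees. Doubling the denominator in the hypothesis
  -- gives the integer coefficient `18k² + 23k + 6`.
  refine hcon.1 ((SparseBook.coBookFree_of_not_isContained hcon.2).isContained
    (n := n) (l := G.edgeFinset.card - n) hk (by simp) hn ?_ G hG hcard ?_)
  · rcases le_total G.edgeFinset.card n with h | h
    · simp [Nat.sub_eq_zero_of_le h]
    have hpos : (0 : ℝ) < 9 * (k : ℝ) ^ 2 + 23 * (k : ℝ) / 2 + 3 := by positivity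
    have h1 : ((G.edgeFinset.card : ℝ) - n) ≤
        n / (9 * (k : ℝ) ^ 2 + 23 * (k : ℝ) / 2 + 3) := by
      have : (n : ℝ) * (1 + 1 / (9 * (k : ℝ) ^ 2 + 23 * (k : ℝ) / 2 + 3)) =
        n + n / (9 * (k : ℝ) ^ 2 + 23 * (k : ℝ) / 2 + 3) := by ring
      linarith
    rw [le_div_iff₀ hpos] at h1
    rw [← @Nat.cast_le ℝ]
    push_cast [h]
    linarith
  · rw [SparseBook.ncard_edgeSet_eq_card]
    omega
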